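/- Let $d\ge 1$, let $X_1,X_2,\dots$ be i.i.d. random vectors in $\mathbb{R}^d$ such that the support of the law of $X_1$ is not contained in any $(d-1)$-dimensional linear subspace of $\mathbb{R}^d$, and let $S_0=0$, $S_n=\sum_{k=1}^n X_k$. Let $\|\cdot\|$ be the Euclidean norm, write $\mathbb{S}^{d-1}=\{x\in\mathbb{R}^d:\|x\|=1\}$, $\hat x = x/\|x\|$ for $x\neq 0$, and $\hat 0=0$. Define the deterministic sets of almost-sure recurrent directions and almost-sure asymptotic directions $$\mathcal{D}=\Bigl\{u\in\mathbb{S}^{d-1}:\ \liminf_{n\to\infty}\|\hat S_n-u\|=0\ \text{a.s.}\Bigr\},$$ $$\mathcal{D}_\infty=\Bigl\{u\in\mathbb{S}^{d-1}:\ \liminf_{n\to\infty}\Bigl(\tfrac{1}{1+\|S_n\|}+\|\hat S_n-u\|\Bigr)=0\ \text{a.s.}\Bigr\},$$ and the random set of asymptotic directions $$L_\infty=\Bigl\{u\in\mathbb{S}^{d-1}:\ \liminf_{n\to\infty}\Bigl(\tfrac{1}{1+\|S_n\|}+\|\hat S_n-u\|\Bigr)=0\Bigr\};$$ that is, $u\in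 L_\infty$ if and only if $u \in \mathbb{S}^{d-1}$ and there is a (random) subsequence $n_k$ with $\|S_{n_k}\|\to\infty$ and $\hat S_{n_k}\to u$. Then $$\mathcal{D}_\infty=\mathcal{D}\qquad\text{and}\qquad \mathbb{P}(L_\infty=\mathcal{D})=1.$$ -/

import Mathlib

open MeasureTheory ProbabilityTheory Filter Topology

namespace RandomWalkDirections

/-- The walk `S_n = ∑_{k=1}^n X_k`, `S_0 = 0`; the i.i.d. increments `X_1, X_2, …` are indexed
here by `0, 1, 2, …`, so `X k` is the increment from time `k` to time `k + 1`. -/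
noncomputable def walk {d : ℕ} {Ω : Type*} (X : ℕ → Ω → EuclideanSpace ℝ (Fin d))
    (n : ℕ) (ω : Ω) : EuclideanSpace ℝ (Fin d) :=
  ∑ k ∈ Finset.range n, X k ω

/-- The projection `x̂ = x / ‖x‖` for `x ≠ 0`, with the convention that `0̂ = 0`. -/
noncomputable def hat {d : ℕ} (x : EuclideanSpace ℝ (Fin d)) : EuclideanSpace ℝ (Fin d) :=
  ‖x‖⁻¹ • x

/-- The law of the increment `Y` is genuinely `d`-dimensional: the support of `Y` is contained in no
`(d-1)`-dimensional linear subspace (used with `1 ≤ d`). -/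
def GenuinelyDimensional {d : ℕ} {Ω : Type*} [MeasurableSpace Ω] (P : Measure Ω)
    (Y : Ω → EuclideanSpace ℝ (Fin d)) : Prop :=
  ∀ V : Submodule ℝ (EuclideanSpace ℝ (Fin d)), Module.finrank ℝ V = d - 1 →
    ¬ (P.map Y).support ⊆ (V : Set (EuclideanSpace ℝ (Fin d)))

/-- The set `L_∞` of asymptotic directions of a trajectory `s`. The sequence whose lower limit is
taken is bounded, so this real `liminf` has no junk value. -/
def asymptoticDirections {d : ℕ} (s : ℕ → EuclideanSpace ℝ (Fin d)) :
    Set (EuclideanSpace ℝ (Fin d)) :=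
  {u | u ∈ Metric.sphere (0 : EuclideanSpace ℝ (Fin d)) 1 ∧
    liminf (fun n => 1 / (1 + ‖s n‖) + ‖hat (s n) - u‖) atTop = 0}

/-- The deterministic set `𝒟` of almost-sure recurrent directions of a process `S`. -/
def asRecurrentDirections {d : ℕ} {Ω : Type*} [MeasurableSpace Ω] (P : Measure Ω)
    (S : ℕ → Ω → EuclideanSpace ℝ (Fin d)) : Set (EuclideanSpace ℝ (Fin d)) :=
  {u | u ∈ Metric.sphere (0 : EuclideanSpace ℝ (Fin d)) 1 ∧
    ∀ᵐ ω ∂P, liminf (fun n => ‖hat (S n ω) - u‖) atTop = 0}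

/-- The deterministic set `𝒟_∞` of almost-sure asymptotic directions of a process `S`. -/
def asAsymptoticDirections {d : ℕ} {Ω : Type*} [MeasurableSpace Ω] (P : Measure Ω)
    (S : ℕ → Ω → EuclideanSpace ℝ (Fin d)) : Set (EuclideanSpace ℝ (Fin d)) :=
  {u | u ∈ Metric.sphere (0 : EuclideanSpace ℝ (Fin d)) 1 ∧
    ∀ᵐ ω ∂P, liminf (fun n => 1 / (1 + ‖S n ω‖) + ‖hat (S n ω) - u‖) atTop = 0}

theorem norm_hat_le_one {d : ℕ} (x : EuclideanSpace ℝ (Fin d)) : ‖hat x‖ ≤ 1 := by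
  unfold hat
  rw [norm_smul, norm_inv, norm_norm]
  exact inv_mul_le_one

theorem liminf_eq_zero_iff (a : ℕ → ℝ) (C : ℝ) (h0 : ∀ n, 0 ≤ a n) (hC : ∀ n, a n ≤ C) :
    liminf a atTop = 0 ↔ ∃ φ : ℕ → ℕ, StrictMono φ ∧ Tendsto (a ∘ φ) atTop (𝓝 0) := by
  have hb : IsBoundedUnder (· ≥ ·) atTop a := isBoundedUnder_of ⟨0, h0⟩
  have hc : IsCoboundedUnder (· ≥ ·) atTop a :=
    (isBoundedUnder_of ⟨C, hC⟩ : IsBoundedUnder (· ≤ ·) atTop a).isCoboundedUnder_ge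
  constructor
  · intro h
    have hf : ∀ k : ℕ, ∃ᶠ n in atTop, a n < 1 / ((k : ℝ) + 1) := fun k =>
      frequently_lt_of_liminf_lt hc (by rw [h]; positivity)
    obtain ⟨φ, hφ, hφ'⟩ := extraction_forall_of_frequently hf
    exact ⟨φ, hφ, squeeze_zero (fun k => h0 _) (fun k => (hφ' k).le)
      tendsto_one_div_add_atTop_nhds_zero_nat⟩
  · rintro ⟨φ, hφ, hlim⟩
    apply le_antisymm
    · apply le_of_forall_pos_le_add
      intro ε hε
      rw [zero_add]
      refine liminf_le_of_frequently_le ?_ hb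
      have h1 : ∀ᶠ k in atTop, a (φ k) ≤ ε :=
        (hlim.eventually (gt_mem_nhds hε)).mono fun k hk => le_of_lt hk
      exact hφ.tendsto_atTop.frequently h1.frequently
    · exact le_liminf_of_le hc (Eventually.of_forall h0)

/-- Asymptotic directions are exactly the unit vectors which are limits of `hat (s n)` along
subsequences on which the norm tends to infinity. -/
theorem mem_asymptoticDirections_iff {d : ℕ} (s : ℕ → EuclideanSpace ℝ (Fin d))
    (u : EuclideanSpace ℝ (Fin d)) :
    u ∈ asymptoticDirections s ↔ ‖u‖ = 1 ∧ ∃ φ : ℕ → ℕ, StrictMono φ ∧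
      Tendsto (fun k => ‖s (φ k)‖) atTop atTop ∧
      Tendsto (fun k => hat (s (φ k))) atTop (𝓝 u) := by
  have hpos : ∀ n, 0 < 1 + ‖s n‖ := fun n => by positivity
  unfold asymptoticDirections
  rw [Set.mem_ofPred_eq, mem_sphere_zero_iff_norm]
  refine and_congr_right fun hu => ?_
  rw [liminf_eq_zero_iff _ 3 (fun n => by positivity)]
  · refine exists_congr fun φ => and_congr_right fun _ => ?_
    constructor
    · intro h
      have h1 : Tendsto (fun k => (1 + ‖s (φ k)‖)⁻¹) atTop (𝓝 0) := by
        refine squeeze_zero (fun k => (inv_pos.2 (hpos _)).le) (fun k => ?_) h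
        simp only [Function.comp, one_div]
        exact le_add_of_nonneg_right (norm_nonneg _)
      have h2 : Tendsto (fun k => ‖hat (s (φ k)) - u‖) atTop (𝓝 0) := by
        refine squeeze_zero (fun k => norm_nonneg _) (fun k => ?_) h
        simp only [Function.comp, one_div]
        exact le_add_of_nonneg_left (inv_pos.2 (hpos _)).le
      refine ⟨?_, tendsto_iff_norm_sub_tendsto_zero.2 h2⟩
      have h3 : Tendsto (fun k => (1 + ‖s (φ k)‖)⁻¹) atTop (𝓝[>] 0) :=
        tendsto_nhdsWithin_iff.2 ⟨h1, Eventually.of_forall fun k => inv_pos.2 (hpos _)⟩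
      have h4 := h3.inv_tendsto_nhdsGT_zero
      have h5 := tendsto_atTop_add_const_left atTop (-1 : ℝ) h4
      refine h5.congr fun k => ?_
      simp
    · rintro ⟨h1, h2⟩
      have h3 := (tendsto_atTop_add_const_left atTop (1 : ℝ) h1).inv_tendsto_atTop
      have h4 := h3.add (tendsto_iff_norm_sub_tendsto_zero.1 h2)
      rw [add_zero] at h4
      refine h4.congr fun k => ?_
      simp [Function.comp]
  · intro n
    have h1 : 1 / (1 + ‖s n‖) ≤ 1 := by
      rw [div_le_one (hpos n)]
      exact le_add_of_nonneg_right (norm_nonneg _)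
    have h2 := norm_sub_le (hat (s n)) u
    have h3 := norm_hat_le_one (s n)
    linarith

end RandomWalkDirections

/-!
The set of asymptotic directions of a trajectory does not change when finitely many increments are
dropped: this translates the walk by a constant, which moves the direction of a point of large norm
by very little. Membership in this set is decided by countably many shift-invariant events
(`ApproachesBall`), so Kolmogorov's zero-one law makes the set almost surely equal to a
deterministic set (`exists_ae_asymptoticDirections_eq`), which can only be the set of almost-sure
asymptotic directions.

It remains to see that a recurrent direction is an asymptotic direction. This is clear if the norm
of the walk tends to infinity almost surely. Otherwise the walk is recurrent at the origin
(`isRecurrent_zero`). Its recurrent values then form a group containing the support of the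
increments (`recurrentSubgroup`, `IsPossible.mem_recurrentSubgroup`), hence spanning the space.
A spanning subgroup comes within bounded distance of every multiple `t • u` of a unit vector `u`
(`exists_norm_sub_smul_le`). Visits near such points with `t` large show that every unit vector is
almost surely an asymptotic direction (`ae_mem_asymptoticDirections_of_span`).
-/

namespace RandomWalkDirections

/-! ### Independent sequences and the shift -/

/-- The sequence `x` with its first `n` terms dropped. -/
def shift {E : Type*} (n : ℕ) (x : ℕ → E) : ℕ → E := fun k => x (n + k)

/-- The sequence `x` with all terms from the `n`-th on replaced by zero. -/
def truncate {E : Type*} [Zero E] (n : ℕ) (x : ℕ → E) : ℕ → E :=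
  fun k => if k < n then x k else 0

section Sequences

variable {Ω E : Type*} [mΩ : MeasurableSpace Ω] [mE : MeasurableSpace E] {P : Measure Ω}
  {X : ℕ → Ω → E}

theorem measurable_shift (n : ℕ) : Measurable (shift n : (ℕ → E) → ℕ → E) :=
  measurable_pi_iff.2 fun _ => measurable_pi_apply _

theorem measurable_iSup_comap {Ω E : Type*} [mE : MeasurableSpace E] {X : ℕ → Ω → E} {S : Set ℕ}
    {i : ℕ} (hi : i ∈ S) : Measurable[⨆ i ∈ S, mE.comap (X i)] (X i) :=
  Measurable.mono (comap_measurable (X i))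
    (le_iSup₂_of_le (f := fun i (_ : i ∈ S) => mE.comap (X i)) i hi le_rfl) le_rfl

/-- The tail of an i.i.d. sequence has the same law as the whole sequence. -/
theorem measure_shift_eq [IsProbabilityMeasure P]
    (hindep : iIndepFun X P) (hident : ∀ n, IdentDistrib (X n) (X 0) P P) (n : ℕ)
    {B : Set (ℕ → E)} (hB : MeasurableSet B) :
    P {ω | shift n (fun k => X k ω) ∈ B} = P {ω | (fun k => X k ω) ∈ B} := by
  have h1 : iIndepFun (fun k => X (n + k)) P :=
    hindep.precomp (g := fun k => n + k) (add_right_injective n)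
  have h2 : IdentDistrib (fun ω k => X (n + k) ω) (fun ω k => X k ω) P P :=
    IdentDistrib.pi (fun k => (hident (n + k)).trans (hident k).symm) h1 hindep
  exact IdentDistrib.measure_mem_eq h2 hB

/-- An event that depends only on the first `n` terms is independent of the terms that follow. The
dependence is encoded by invariance under truncation at `n`. -/
theorem measure_inter_shift [Zero E] [IsProbabilityMeasure P] (hmeas : ∀ n, Measurable (X n))
    (hindep : iIndepFun X P) (hident : ∀ n, IdentDistrib (X n) (X 0) P P) (n : ℕ)
    {A B : Set (ℕ → E)} (hA : MeasurableSet A) (hAn : ∀ x, truncate n x ∈ A ↔ x ∈ A)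
    (hB : MeasurableSet B) :
    P {ω | (fun k => X k ω) ∈ A ∧ shift n (fun k => X k ω) ∈ B} =
      P {ω | (fun k => X k ω) ∈ A} * P {ω | (fun k => X k ω) ∈ B} := by
  have hi := indep_iSup_of_disjoint (fun i => (hmeas i).comap_le)
    ((iIndepFun_iff_iIndep _ _ _).1 hindep) (S := Set.Iio n) (T := Set.Ici n)
    (Set.disjoint_left.2 fun i hi hi' => not_lt.2 (Set.mem_Ici.1 hi') (Set.mem_Iio.1 hi))
  rw [← measure_shift_eq hindep hident n hB]
  refine (Indep_iff _ _ P).1 hi _ _ ?_ ?_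
  · have h : Measurable[⨆ i ∈ Set.Iio n, mE.comap (X i)]
        (fun ω => truncate n (fun k => X k ω)) := by
      refine (@measurable_pi_iff _ _ _ (⨆ i ∈ Set.Iio n, mE.comap (X i)) _ _).2 fun k => ?_
      unfold truncate
      by_cases hk : k < n
      · simpa only [hk, if_true] using measurable_iSup_comap (X := X) (S := Set.Iio n) hk
      · simpa only [hk, if_false] using measurable_const
    have := h hA
    simp only [Set.preimage, hAn] at this
    exact this
  · have h : Measurable[⨆ i ∈ Set.Ici n, mE.comap (X i)]
        (fun ω => shift n (fun k => X k ω)) :=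
      (@measurable_pi_iff _ _ _ (⨆ i ∈ Set.Ici n, mE.comap (X i)) _ _).2 fun k =>
        measurable_iSup_comap (X := X) (S := Set.Ici n) (Nat.le_add_right n k)
    exact h hB

/-- Kolmogorov's zero-one law for shift-invariant events. -/
theorem measure_zero_or_one_of_shift (hmeas : ∀ n, Measurable (X n))
    (hindep : iIndepFun X P) {B : Set (ℕ → E)} (hB : MeasurableSet B)
    (hinv : ∀ n x, shift n x ∈ B ↔ x ∈ B) :
    P {ω | (fun k => X k ω) ∈ B} = 0 ∨ P {ω | (fun k => X k ω) ∈ B} = 1 := by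
  refine measure_zero_or_one_of_measurableSet_limsup_atTop (fun i => (hmeas i).comap_le)
    ((iIndepFun_iff_iIndep _ _ _).1 hindep) ?_
  rw [limsup_eq_iInf_iSup_of_nat]
  rw [MeasurableSpace.measurableSet_iInf]
  intro n
  have h : Measurable[⨆ i ∈ Set.Ici n, mE.comap (X i)] (fun ω => shift n (fun k => X k ω)) :=
    (@measurable_pi_iff _ _ _ (⨆ i ∈ Set.Ici n, mE.comap (X i)) _ _).2 fun k =>
      measurable_iSup_comap (X := X) (S := Set.Ici n) (Nat.le_add_right n k)
  have := h hB
  simp only [Set.preimage, hinv] at this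
  exact this

end Sequences

/-! ### Recurrent values form a group -/

/-- The walk with increments `x 0, x 1, …`, as a function of the increment sequence. -/
def partialSum {E : Type*} [AddCommMonoid E] (x : ℕ → E) (n : ℕ) : E :=
  ∑ k ∈ Finset.range n, x k

theorem partialSum_add {E : Type*} [AddCommMonoid E] (x : ℕ → E) (n m : ℕ) :
    partialSum x (n + m) = partialSum x n + partialSum (shift n x) m :=
  Finset.sum_range_add x n m

theorem partialSum_truncate {E : Type*} [AddCommMonoid E] (x : ℕ → E) {n m : ℕ} (h : m ≤ n) :
    partialSum (truncate n x) m = partialSum x m :=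
  Finset.sum_congr rfl fun _ hk => if_pos ((Finset.mem_range.1 hk).trans_le h)

theorem frequently_add_left_iff {p : ℕ → Prop} (n : ℕ) :
    (∃ᶠ m in atTop, p (n + m)) ↔ ∃ᶠ m in atTop, p m := by
  conv_rhs => rw [← map_add_atTop_eq_nat n]
  rw [frequently_map]
  simp only [add_comm n]

theorem measurableSet_frequently {α : Type*} [MeasurableSpace α] {p : ℕ → α → Prop}
    (h : ∀ n, MeasurableSet {a | p n a}) : MeasurableSet {a | ∃ᶠ n in atTop, p n a} := by
  simp only [frequently_atTop, Set.ofPred_forall, Set.ofPred_exists, Set.ofPred_and]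
  exact .iInter fun N => .iUnion fun n => (MeasurableSet.const _).inter (h n)

/-- Under the law `μ` of the increments, what happens before a fixed time is independent of the
increments after that time, and the latter again have law `μ`. -/
def HasIndependentShifts {E : Type*} [Zero E] [MeasurableSpace E] (μ : Measure (ℕ → E)) : Prop :=
  ∀ (n : ℕ) (A B : Set (ℕ → E)), MeasurableSet A → (∀ x, truncate n x ∈ A ↔ x ∈ A) →
    MeasurableSet B → μ (A ∩ shift n ⁻¹' B) = μ A * μ B

section Recurrence

variable {E : Type*} [NormedAddCommGroup E]

/-- The increment sequences whose walk visits the ball of radius `δ` about `y` infinitely often. -/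
def visits (y : E) (δ : ℝ) : Set (ℕ → E) :=
  {x | ∃ᶠ n in atTop, ‖partialSum x n - y‖ < δ}

variable [MeasurableSpace E]

/-- A value all of whose neighbourhoods are almost surely visited infinitely often. -/
def IsRecurrent (μ : Measure (ℕ → E)) (y : E) : Prop :=
  ∀ ε : ℝ, 0 < ε → μ (visits y ε) = 1

/-- A value all of whose neighbourhoods are visited with positive probability at some time. -/
def IsPossible (μ : Measure (ℕ → E)) (y : E) : Prop :=
  ∀ ε : ℝ, 0 < ε → ∃ n, μ {x | ‖partialSum x n - y‖ < ε} ≠ 0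

theorem IsRecurrent.isPossible {μ : Measure (ℕ → E)} {y : E} (h : IsRecurrent μ y) :
    IsPossible μ y := by
  intro ε hε
  by_contra! hn
  have h0 : μ (⋃ n, {x | ‖partialSum x n - y‖ < ε}) = 0 := measure_iUnion_null hn
  have h1 : μ (visits y ε) = 0 := by
    refine measure_mono_null (fun x hx => ?_) h0
    obtain ⟨n, hn⟩ := Frequently.exists hx
    exact Set.mem_iUnion.2 ⟨n, hn⟩
  rw [h ε hε] at h1
  exact one_ne_zero h1

variable [BorelSpace E] [SecondCountableTopology E]

theorem measurable_partialSum (n : ℕ) : Measurable fun x : ℕ → E => partialSum x n :=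
  Finset.measurable_fun_sum _ fun _ _ => measurable_pi_apply _

theorem measurableSet_near (n : ℕ) (y : E) (δ : ℝ) :
    MeasurableSet {x : ℕ → E | ‖partialSum x n - y‖ < δ} :=
  measurableSet_lt ((measurable_partialSum n).sub_const y).norm measurable_const

theorem measurableSet_visits (y : E) (δ : ℝ) : MeasurableSet (visits y δ) :=
  measurableSet_frequently fun n => measurableSet_near n y δ

/-- If a ball is visited infinitely often with positive probability, then the walk almost surely
returns infinitely often to within its diameter of the origin: restarting the walk at its first
visit after time `N` bounds the probability of infinitely many visits by the probability of a visit
after time `N` times the probability of infinitely many returns. -/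
theorem measure_visits_zero_eq_one {μ : Measure (ℕ → E)} [IsProbabilityMeasure μ]
    (hμ : HasIndependentShifts μ) {y : E} {δ : ℝ} (h : μ (visits y δ) ≠ 0) :
    μ (visits 0 (2 * δ)) = 1 := by
  set p := μ (visits (0 : E) (2 * δ)) with hp
  let A : ℕ → Set (ℕ → E) := fun N => {x | ∃ n, N ≤ n ∧ ‖partialSum x n - y‖ < δ}
  -- `F N n` is the event that the first visit at or after time `N` happens at time `n`.
  let F : ℕ → ℕ → Set (ℕ → E) := fun N n =>
    {x | (N ≤ n ∧ ‖partialSum x n - y‖ < δ) ∧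
      ∀ m, m < n → ¬ (N ≤ m ∧ ‖partialSum x m - y‖ < δ)}
  have hAmeas : ∀ N, MeasurableSet (A N) := fun N => by
    simp only [A, Set.ofPred_exists, Set.ofPred_and]
    exact .iUnion fun n => (MeasurableSet.const _).inter (measurableSet_near n y δ)
  have hFmeas : ∀ N n, MeasurableSet (F N n) := fun N n => by
    have h1 : ∀ m, MeasurableSet {x : ℕ → E | N ≤ m ∧ ‖partialSum x m - y‖ < δ} := fun m =>
      (MeasurableSet.const _).inter (measurableSet_near m y δ)
    have h2 : MeasurableSet {x : ℕ → E |
        ∀ m, m < n → ¬ (N ≤ m ∧ ‖partialSum x m - y‖ < δ)} := by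
      simp only [Set.ofPred_forall]
      exact .iInter fun m => .iInter fun _ => (h1 m).compl
    exact (h1 n).inter h2
  have hFtrunc : ∀ N n x, truncate n x ∈ F N n ↔ x ∈ F N n := fun N n x => by
    have h1 : ∀ m, m < n → partialSum (truncate n x) m = partialSum x m := fun m hm =>
      partialSum_truncate x hm.le
    simp only [F, Set.mem_ofPred_eq, partialSum_truncate x le_rfl]
    refine and_congr_right fun _ => forall₂_congr fun m hm => ?_
    rw [h1 m hm]
  have hFdisj : ∀ N, Pairwise (Function.onFun Disjoint (F N)) := fun N m n hmn => by
    refine Set.disjoint_left.2 fun x hm hn => ?_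
    rcases lt_or_gt_of_ne hmn with h' | h'
    · exact hn.2 m h' hm.1
    · exact hm.2 n h' hn.1
  have hFunion : ∀ N, ⋃ n, F N n = A N := fun N => by
    ext x
    simp only [Set.mem_iUnion]
    constructor
    · rintro ⟨n, hn⟩
      exact ⟨n, hn.1⟩
    · intro hx
      classical
      exact ⟨Nat.find hx, Nat.find_spec hx, fun m hm => Nat.find_min hx hm⟩
  have hbound : ∀ N, μ (visits y δ) ≤ μ (A N) * p := fun N => by
    have hsub : visits y δ ⊆ ⋃ n, F N n ∩ shift n ⁻¹' visits 0 (2 * δ) := by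
      intro x hx
      have hxA : x ∈ ⋃ n, F N n := by
        rw [hFunion]
        exact frequently_atTop.1 hx N
      obtain ⟨n, hn⟩ := Set.mem_iUnion.1 hxA
      refine Set.mem_iUnion.2 ⟨n, hn, ?_⟩
      refine Frequently.mono ((frequently_add_left_iff n).2 hx) fun m hm => ?_
      have h1 : partialSum (shift n x) m - 0 =
          (partialSum x (n + m) - y) - (partialSum x n - y) := by
        rw [partialSum_add]; abel
      rw [h1]
      have h2 := norm_sub_le (partialSum x (n + m) - y) (partialSum x n - y)
      have h3 := hn.1.2
      linarith
    calc μ (visits y δ) ≤ μ (⋃ n, F N n ∩ shift n ⁻¹' visits 0 (2 * δ)) := measure_mono hsub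
      _ ≤ ∑' n, μ (F N n ∩ shift n ⁻¹' visits 0 (2 * δ)) := measure_iUnion_le _
      _ = ∑' n, μ (F N n) * p := tsum_congr fun n =>
          hμ n _ _ (hFmeas N n) (hFtrunc N n) (measurableSet_visits _ _)
      _ = μ (A N) * p := by
          rw [ENNReal.tsum_mul_right, ← measure_iUnion (hFdisj N) (hFmeas N), hFunion]
  have hlim : Tendsto (fun N => μ (A N)) atTop (𝓝 (μ (visits y δ))) := by
    have h1 : visits y δ = ⋂ N, A N := by
      ext x
      simp only [visits, A, Set.mem_ofPred_eq, frequently_atTop, Set.mem_iInter]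
    rw [h1]
    refine tendsto_measure_iInter_atTop (fun N => (hAmeas N).nullMeasurableSet) ?_
      ⟨0, measure_ne_top _ _⟩
    rintro M N hMN x ⟨n, hn, hn'⟩
    exact ⟨n, hMN.trans hn, hn'⟩
  have hpt : p ≠ ⊤ := measure_ne_top _ _
  have hle : μ (visits y δ) ≤ μ (visits y δ) * p :=
    ge_of_tendsto' (ENNReal.Tendsto.mul_const hlim (Or.inr hpt)) hbound
  refine le_antisymm prob_le_one ?_
  have h2 : μ (visits y δ) * 1 ≤ μ (visits y δ) * p := by rwa [mul_one]
  exact (ENNReal.mul_le_mul_iff_right h (measure_ne_top _ _)).1 h2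

/-- A walk that has come near `z` and still returns near `y` infinitely often must cover the
displacement `y - z` infinitely often with its later increments. -/
theorem IsRecurrent.sub {μ : Measure (ℕ → E)} [IsProbabilityMeasure μ]
    (hμ : HasIndependentShifts μ) {y z : E} (hy : IsRecurrent μ y) (hz : IsPossible μ z) :
    IsRecurrent μ (y - z) := by
  intro ε hε
  obtain ⟨n, hn⟩ := hz (ε / 2) (half_pos hε)
  rw [← prob_compl_eq_zero_iff (measurableSet_visits _ _)]
  have h1 := hμ n _ _ (measurableSet_near n z (ε / 2))
    (fun x => by simp only [Set.mem_ofPred_eq, partialSum_truncate x le_rfl])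
    (measurableSet_visits (y - z) ε).compl
  have h2 : μ ({x | ‖partialSum x n - z‖ < ε / 2} ∩ shift n ⁻¹' (visits (y - z) ε)ᶜ) = 0 := by
    have h3 := (prob_compl_eq_zero_iff (measurableSet_visits y (ε / 2))).2
      (hy (ε / 2) (half_pos hε))
    refine measure_mono_null ?_ h3
    rintro x ⟨hx, hx'⟩ hv
    refine hx' (Frequently.mono ((frequently_add_left_iff n).2 hv) fun m hm => ?_)
    have h4 : partialSum (shift n x) m - (y - z) =
        (partialSum x (n + m) - y) - (partialSum x n - z) := by
      rw [partialSum_add]; abel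
    rw [h4]
    have h5 := norm_sub_le (partialSum x (n + m) - y) (partialSum x n - z)
    have h6 : ‖partialSum x n - z‖ < ε / 2 := hx
    linarith
  rw [h1] at h2
  exact (mul_eq_zero.1 h2).resolve_left hn

/-- The group of recurrent values of a walk that returns to the origin. -/
def recurrentSubgroup (μ : Measure (ℕ → E)) [IsProbabilityMeasure μ]
    (hμ : HasIndependentShifts μ) (h0 : IsRecurrent μ 0) : AddSubgroup E :=
  AddSubgroup.ofSub {y | IsRecurrent μ y} ⟨0, h0⟩ fun y hy z hz => by
    rw [← sub_eq_add_neg]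
    exact IsRecurrent.sub hμ hy (IsRecurrent.isPossible hz)

theorem IsPossible.mem_recurrentSubgroup {μ : Measure (ℕ → E)} [IsProbabilityMeasure μ]
    (hμ : HasIndependentShifts μ) (h0 : IsRecurrent μ 0) {y : E} (hy : IsPossible μ y) :
    y ∈ recurrentSubgroup μ hμ h0 := by
  have h1 : (0 : E) - y ∈ recurrentSubgroup μ hμ h0 := IsRecurrent.sub hμ h0 hy
  rw [zero_sub] at h1
  exact neg_mem_iff.1 h1

/-- A walk whose norm does not tend to infinity almost surely is recurrent at the origin. Some ball
is visited infinitely often with positive probability; it is covered by finitely many small balls,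
one of which is then also visited infinitely often with positive probability. -/
theorem isRecurrent_zero [ProperSpace E] {μ : Measure (ℕ → E)} [IsProbabilityMeasure μ]
    (hμ : HasIndependentShifts μ)
    (h : ¬ ∀ᵐ x ∂μ, Tendsto (fun n => ‖partialSum x n‖) atTop atTop) : IsRecurrent μ 0 := by
  obtain ⟨R, hR⟩ : ∃ R : ℕ, μ (visits (0 : E) R) ≠ 0 := by
    -- otherwise almost every trajectory eventually leaves each ball for good
    by_contra! hn
    refine h ?_
    have h1 : ∀ᵐ x ∂μ, ∀ R : ℕ, x ∉ visits (0 : E) R :=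
      ae_all_iff.2 fun R => measure_eq_zero_iff_ae_notMem.1 (hn R)
    filter_upwards [h1] with x hx
    refine tendsto_atTop.2 fun b => ?_
    obtain ⟨R, hR⟩ := exists_nat_ge b
    have h2 := hx R
    simp only [visits, Set.mem_ofPred_eq, not_frequently, sub_zero, not_lt] at h2
    exact h2.mono fun n hn => hR.trans hn
  intro ε hε
  obtain ⟨t, -, ht, hcov⟩ := (isCompact_closedBall (0 : E) R).finite_cover_balls (half_pos hε)
  obtain ⟨y, -, hy⟩ : ∃ y ∈ t, μ (visits y (ε / 2)) ≠ 0 := by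
    by_contra! hn
    refine hR (measure_mono_null (fun x hx => ?_) ((measure_biUnion_null_iff ht.countable).2 hn))
    -- infinitely many visits to a finite union of balls: one ball gets infinitely many
    have h1 : ∃ᶠ n in atTop, ∃ y ∈ t, ‖partialSum x n - y‖ < ε / 2 := by
      refine Frequently.mono hx fun n hn => ?_
      have h2 : partialSum x n ∈ Metric.closedBall (0 : E) R :=
        mem_closedBall_iff_norm.2 hn.le
      obtain ⟨y, hy, hy'⟩ := Set.mem_iUnion₂.1 (hcov h2)
      exact ⟨y, hy, mem_ball_iff_norm.1 hy'⟩
    by_contra hx'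
    simp only [Set.mem_iUnion, not_exists, visits, Set.mem_ofPred_eq, not_frequently] at hx'
    refine h1 ?_
    have h3 := (eventually_all_finite ht).2 hx'
    refine h3.mono fun n hn => ?_
    push Not
    simpa using hn
  have h4 := measure_visits_zero_eq_one hμ hy
  rwa [mul_div_cancel₀ _ (two_ne_zero' ℝ)] at h4

end Recurrence

/-! ### Coarse density of a spanning subgroup -/

/-- A subgroup spanning a real normed space comes within bounded distance of every point of each
line through the origin. -/
theorem exists_norm_sub_smul_le {E : Type*} [NormedAddCommGroup E] [NormedSpace ℝ E]
    (G : AddSubgroup E) (hG : Submodule.span ℝ (G : Set E) = ⊤) (u : E) :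
    ∃ C : ℝ, ∀ t : ℝ, ∃ g ∈ G, ‖g - t • u‖ ≤ C := by
  have hu : u ∈ Submodule.span ℝ (G : Set E) := hG ▸ Submodule.mem_top
  induction hu using Submodule.span_induction with
  | mem y hy =>
    refine ⟨‖y‖, fun t => ⟨⌊t⌋ • y, G.zsmul_mem hy _, ?_⟩⟩
    rw [← Int.cast_smul_eq_zsmul ℝ, ← sub_smul, norm_smul]
    refine mul_le_of_le_one_left (norm_nonneg _) ?_
    rw [Real.norm_eq_abs, abs_le]
    constructor <;> linarith [Int.floor_le t, Int.lt_floor_add_one t]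
  | zero => exact ⟨0, fun t => ⟨0, G.zero_mem, by simp⟩⟩
  | add y z _ _ hy hz =>
    obtain ⟨C, hC⟩ := hy
    obtain ⟨D, hD⟩ := hz
    refine ⟨C + D, fun t => ?_⟩
    obtain ⟨g, hg, hg'⟩ := hC t
    obtain ⟨k, hk, hk'⟩ := hD t
    refine ⟨g + k, G.add_mem hg hk, ?_⟩
    rw [smul_add, add_sub_add_comm]
    exact (norm_add_le _ _).trans (add_le_add hg' hk')
  | smul a y _ hy =>
    obtain ⟨C, hC⟩ := hy
    refine ⟨C, fun t => ?_⟩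
    obtain ⟨g, hg, hg'⟩ := hC (t * a)
    exact ⟨g, hg, by rwa [smul_smul]⟩

/-! ### Asymptotic directions -/

section Directions

variable {d : ℕ}

theorem norm_smul_hat (x : EuclideanSpace ℝ (Fin d)) : ‖x‖ • hat x = x := by
  rcases eq_or_ne x 0 with rfl | hx
  · simp
  · rw [hat, smul_smul, mul_inv_cancel₀ (norm_ne_zero_iff.2 hx), one_smul]

theorem norm_mul_norm_hat_sub_hat_le (x y : EuclideanSpace ℝ (Fin d)) :
    ‖x‖ * ‖hat x - hat y‖ ≤ 2 * ‖x - y‖ := by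
  have h1 : ‖x‖ • (hat x - hat y) = (x - y) + (‖y‖ - ‖x‖) • hat y := by
    rw [smul_sub, sub_smul, norm_smul_hat, norm_smul_hat]
    abel
  have h2 : ‖x‖ * ‖hat x - hat y‖ = ‖(x - y) + (‖y‖ - ‖x‖) • hat y‖ := by
    rw [← h1, norm_smul, norm_norm]
  have h3 : ‖(‖y‖ - ‖x‖) • hat y‖ ≤ ‖x - y‖ := by
    rw [norm_smul, Real.norm_eq_abs]
    refine (mul_le_of_le_one_right (abs_nonneg _) (norm_hat_le_one y)).trans ?_
    rw [norm_sub_rev x y]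
    exact abs_norm_sub_norm_le y x
  rw [h2]
  linarith [norm_add_le (x - y) ((‖y‖ - ‖x‖) • hat y)]

theorem hat_smul_of_norm_eq_one {u : EuclideanSpace ℝ (Fin d)} (hu : ‖u‖ = 1) {t : ℝ}
    (ht : 0 < t) : hat (t • u) = u := by
  rw [hat, norm_smul, hu, mul_one, Real.norm_of_nonneg ht.le, smul_smul, inv_mul_cancel₀ ht.ne',
    one_smul]

/-- Along some subsequence the norm of `s` tends to infinity and the direction of `s` approaches the
closed ball of radius `r` about `q`. -/
def ApproachesBall (q : EuclideanSpace ℝ (Fin d)) (r : ℝ) (s : ℕ → EuclideanSpace ℝ (Fin d)) :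
    Prop :=
  ∀ k : ℕ, ∃ᶠ n in atTop, (k : ℝ) < ‖s n‖ ∧ ‖hat (s n) - q‖ < r + 1 / ((k : ℝ) + 1)

theorem mem_asymptoticDirections_iff_approachesBall (s : ℕ → EuclideanSpace ℝ (Fin d))
    (u : EuclideanSpace ℝ (Fin d)) :
    u ∈ asymptoticDirections s ↔ ‖u‖ = 1 ∧ ApproachesBall u 0 s := by
  rw [mem_asymptoticDirections_iff]
  refine and_congr_right fun _ => ⟨?_, fun h => ?_⟩
  · rintro ⟨φ, hφ, h1, h2⟩ k
    have h3 := (tendsto_iff_norm_sub_tendsto_zero.1 h2).eventually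
      (gt_mem_nhds (show (0 : ℝ) < 0 + 1 / ((k : ℝ) + 1) by positivity))
    exact hφ.tendsto_atTop.frequently ((h1.eventually_gt_atTop (k : ℝ)).and h3).frequently
  · obtain ⟨φ, hφ, h1⟩ := extraction_forall_of_frequently h
    refine ⟨φ, hφ, tendsto_atTop_mono (fun k => (h1 k).1.le) tendsto_natCast_atTop_atTop,
      tendsto_iff_norm_sub_tendsto_zero.2 ?_⟩
    refine squeeze_zero (fun k => norm_nonneg _) (fun k => ?_)
      tendsto_one_div_add_atTop_nhds_zero_nat
    simpa using (h1 k).2.le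

theorem ApproachesBall.const_add {q : EuclideanSpace ℝ (Fin d)} {r : ℝ}
    {s : ℕ → EuclideanSpace ℝ (Fin d)} (h : ApproachesBall q r s)
    (c : EuclideanSpace ℝ (Fin d)) : ApproachesBall q r (fun n => c + s n) := by
  intro k
  -- a translation by `c` moves the direction of `s n` by at most `2 * ‖c‖ / ‖s n‖`
  obtain ⟨K, hK⟩ := exists_nat_ge ((1 + 2 * ‖c‖) * ((k : ℝ) + 1))
  refine (h K).mono fun n ⟨h1, h2⟩ => ?_
  have hk : (0 : ℝ) < (k : ℝ) + 1 := by positivity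
  have hc := norm_nonneg c
  have hK' : (1 + 2 * ‖c‖) * ((k : ℝ) + 1) = k + 1 + 2 * ‖c‖ * k + 2 * ‖c‖ := by ring
  have hck : 0 ≤ ‖c‖ * (k : ℝ) := by positivity
  have hKpos : (0 : ℝ) < K := by linarith
  constructor
  · have h3 := norm_sub_le (c + s n) c
    rw [add_sub_cancel_left] at h3
    linarith
  · have h3 := norm_mul_norm_hat_sub_hat_le (s n) (c + s n)
    rw [show s n - (c + s n) = -c by abel, norm_neg, norm_sub_rev] at h3
    have h4 : ‖hat (c + s n) - hat (s n)‖ ≤ 2 * ‖c‖ / K := by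
      rw [le_div_iff₀ hKpos]
      nlinarith [norm_nonneg (hat (c + s n) - hat (s n))]
    have h5 := norm_sub_le_norm_sub_add_norm_sub (hat (c + s n)) (hat (s n)) q
    have h6 : 1 / ((K : ℝ) + 1) ≤ 1 / K := one_div_le_one_div_of_le hKpos (by linarith)
    have h7 : 1 / (K : ℝ) + 2 * ‖c‖ / K ≤ 1 / ((k : ℝ) + 1) := by
      rw [← add_div, div_le_div_iff₀ hKpos hk]
      linarith
    linarith

theorem approachesBall_shift_iff (q : EuclideanSpace ℝ (Fin d)) (r : ℝ) (n : ℕ)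
    (x : ℕ → EuclideanSpace ℝ (Fin d)) :
    ApproachesBall q r (partialSum (shift n x)) ↔ ApproachesBall q r (partialSum x) := by
  have h1 : ApproachesBall q r (fun m => partialSum x (n + m)) ↔
      ApproachesBall q r (partialSum x) :=
    forall_congr' fun k => frequently_add_left_iff
      (p := fun m => (k : ℝ) < ‖partialSum x m‖ ∧
        ‖hat (partialSum x m) - q‖ < r + 1 / ((k : ℝ) + 1)) n
  rw [← h1]
  constructor
  · intro h
    simp only [partialSum_add]
    exact h.const_add _
  · intro h
    have h2 := h.const_add (-partialSum x n)
    simpa only [partialSum_add, neg_add_cancel_left] using h2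

theorem measurableSet_approachesBall (q : EuclideanSpace ℝ (Fin d)) (r : ℝ) :
    MeasurableSet {x : ℕ → EuclideanSpace ℝ (Fin d) | ApproachesBall q r (partialSum x)} := by
  simp only [ApproachesBall, Set.ofPred_forall]
  refine .iInter fun k => measurableSet_frequently fun n => ?_
  have h1 := measurable_partialSum (E := EuclideanSpace ℝ (Fin d)) n
  have h2 : Measurable fun x : ℕ → EuclideanSpace ℝ (Fin d) => hat (partialSum x n) :=
    h1.norm.inv.smul h1
  exact (measurableSet_lt measurable_const h1.norm).inter
    (measurableSet_lt (h2.sub_const q).norm measurable_const)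

/-- Whether `u` is an asymptotic direction is decided by countably many balls. -/
theorem approachesBall_zero_iff (u : EuclideanSpace ℝ (Fin d))
    (s : ℕ → EuclideanSpace ℝ (Fin d)) :
    ApproachesBall u 0 s ↔ ∀ i m : ℕ,
      ‖u - TopologicalSpace.denseSeq (EuclideanSpace ℝ (Fin d)) i‖ < 1 / ((m : ℝ) + 1) →
        ApproachesBall (TopologicalSpace.denseSeq (EuclideanSpace ℝ (Fin d)) i)
          (1 / ((m : ℝ) + 1)) s := by
  constructor
  · intro h i m him k
    refine (h k).mono fun n ⟨h1, h2⟩ => ⟨h1, ?_⟩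
    have h3 := norm_sub_le_norm_sub_add_norm_sub (hat (s n)) u
      (TopologicalSpace.denseSeq (EuclideanSpace ℝ (Fin d)) i)
    linarith
  · intro h k
    -- three errors, each at most `1 / (m + 1)` with `m = 3 * k + 2`, add up to `1 / (k + 1)`
    obtain ⟨i, hi⟩ := (TopologicalSpace.denseRange_denseSeq
      (EuclideanSpace ℝ (Fin d))).exists_dist_lt u
        (show (0 : ℝ) < 1 / (((3 * k + 2 : ℕ) : ℝ) + 1) by positivity)
    rw [dist_eq_norm] at hi
    have hi' := norm_sub_rev u (TopologicalSpace.denseSeq (EuclideanSpace ℝ (Fin d)) i)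
    refine (h i (3 * k + 2) hi (3 * k + 2)).mono fun n ⟨h1, h2⟩ => ?_
    have h3 := norm_sub_le_norm_sub_add_norm_sub (hat (s n))
      (TopologicalSpace.denseSeq (EuclideanSpace ℝ (Fin d)) i) u
    have h4 : 3 * (1 / (((3 * k + 2 : ℕ) : ℝ) + 1)) = 1 / ((k : ℝ) + 1) := by
      have hk : (k : ℝ) + 1 ≠ 0 := by positivity
      rw [show ((3 * k + 2 : ℕ) : ℝ) + 1 = 3 * ((k : ℝ) + 1) by push_cast; ring]
      field_simp
    constructor
    · push_cast at h1
      linarith [Nat.cast_nonneg (α := ℝ) k]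
    · linarith

/-- A random walk satisfying a zero-one law for shift-invariant events has a deterministic set of
asymptotic directions. -/
theorem exists_ae_asymptoticDirections_eq {μ : Measure (ℕ → EuclideanSpace ℝ (Fin d))}
    [IsProbabilityMeasure μ]
    (h01 : ∀ B : Set (ℕ → EuclideanSpace ℝ (Fin d)), MeasurableSet B →
      (∀ n x, shift n x ∈ B ↔ x ∈ B) → μ B = 0 ∨ μ B = 1) :
    ∃ K : Set (EuclideanSpace ℝ (Fin d)), ∀ᵐ x ∂μ, asymptoticDirections (partialSum x) = K := by
  let q := TopologicalSpace.denseSeq (EuclideanSpace ℝ (Fin d))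
  let B : ℕ → ℕ → Set (ℕ → EuclideanSpace ℝ (Fin d)) := fun i m =>
    {x | ApproachesBall (q i) (1 / ((m : ℝ) + 1)) (partialSum x)}
  have hB : ∀ i m, MeasurableSet (B i m) := fun i m => measurableSet_approachesBall _ _
  have h : ∀ᵐ x ∂μ, ∀ i m, x ∈ B i m ↔ μ (B i m) = 1 := by
    refine ae_all_iff.2 fun i => ae_all_iff.2 fun m => ?_
    rcases h01 (B i m) (hB i m) (fun n x => approachesBall_shift_iff _ _ n x) with h0 | h1
    · filter_upwards [measure_eq_zero_iff_ae_notMem.1 h0] with x hx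
      simp [hx, h0]
    · filter_upwards [(prob_compl_eq_zero_iff (hB i m)).2 h1] with x hx
      simp only [h1, iff_true]
      simpa using hx
  refine ⟨{u | ‖u‖ = 1 ∧ ∀ i m : ℕ, ‖u - q i‖ < 1 / ((m : ℝ) + 1) → μ (B i m) = 1}, ?_⟩
  filter_upwards [h] with x hx
  ext u
  rw [mem_asymptoticDirections_iff_approachesBall, approachesBall_zero_iff]
  exact and_congr_right fun _ => forall₂_congr fun i m => imp_congr_right fun _ => hx i m

/-- If the recurrent values span the space, every unit vector is almost surely an asymptotic
direction: the recurrent values come within bounded distance of every multiple of it. -/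
theorem ae_mem_asymptoticDirections_of_span {μ : Measure (ℕ → EuclideanSpace ℝ (Fin d))}
    [IsProbabilityMeasure μ] (hμ : HasIndependentShifts μ) (h0 : IsRecurrent μ 0)
    (hspan : Submodule.span ℝ (recurrentSubgroup μ hμ h0 : Set (EuclideanSpace ℝ (Fin d))) = ⊤)
    {u : EuclideanSpace ℝ (Fin d)} (hu : ‖u‖ = 1) :
    ∀ᵐ x ∂μ, u ∈ asymptoticDirections (partialSum x) := by
  obtain ⟨C, hC⟩ := exists_norm_sub_smul_le _ hspan u
  choose g hg hgC using hC
  have h1 : ∀ᵐ x ∂μ, ∀ N : ℕ, x ∈ visits (g N) 1 := by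
    refine ae_all_iff.2 fun N => ?_
    have h2 : IsRecurrent μ (g N) := hg N
    filter_upwards [(prob_compl_eq_zero_iff (measurableSet_visits _ _)).2 (h2 1 one_pos)] with x hx
    simpa using hx
  filter_upwards [h1] with x hx
  refine (mem_asymptoticDirections_iff_approachesBall _ _).2 ⟨hu, fun k => ?_⟩
  obtain ⟨N, hN⟩ := exists_nat_gt ((2 * (C + 1) + 1) * ((k : ℝ) + 1))
  have hC0 : 0 ≤ C := (norm_nonneg _).trans (hgC 0)
  have hk : (0 : ℝ) < (k : ℝ) + 1 := by positivity
  have hCk : 0 ≤ C * (k : ℝ) := by positivity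
  have hN' : (2 * (C + 1) + 1) * ((k : ℝ) + 1) = 2 * (C * k) + 2 * C + 3 * k + 3 := by ring
  have hNpos : (0 : ℝ) < N := by linarith [Nat.cast_nonneg (α := ℝ) k]
  refine Frequently.mono (hx N) fun n hn => ?_
  have h3 : ‖(N : ℝ) • u - partialSum x n‖ ≤ C + 1 := by
    rw [norm_sub_rev]
    have := norm_sub_le_norm_sub_add_norm_sub (partialSum x n) (g N) ((N : ℝ) • u)
    linarith [hgC N]
  have h4 : ‖(N : ℝ) • u‖ = N := by rw [norm_smul, hu, mul_one, Real.norm_of_nonneg hNpos.le]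
  constructor
  · have h5 := norm_sub_norm_le ((N : ℝ) • u) (partialSum x n)
    linarith [Nat.cast_nonneg (α := ℝ) k]
  · have h5 := norm_mul_norm_hat_sub_hat_le ((N : ℝ) • u) (partialSum x n)
    rw [h4, hat_smul_of_norm_eq_one hu hNpos, norm_sub_rev] at h5
    rw [zero_add, lt_div_iff₀ hk]
    by_contra! hcon
    nlinarith [norm_nonneg (hat (partialSum x n) - u)]

/-- When the norm tends to infinity, a recurrent direction is an asymptotic direction. -/
theorem mem_asymptoticDirections_of_tendsto {s : ℕ → EuclideanSpace ℝ (Fin d)}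
    {u : EuclideanSpace ℝ (Fin d)} (hu : ‖u‖ = 1)
    (hs : Tendsto (fun n => ‖s n‖) atTop atTop)
    (h : liminf (fun n => ‖hat (s n) - u‖) atTop = 0) : u ∈ asymptoticDirections s := by
  obtain ⟨φ, hφ, h1⟩ := (liminf_eq_zero_iff _ 2 (fun n => norm_nonneg _) (fun n => by
    linarith [norm_sub_le (hat (s n)) u, norm_hat_le_one (s n)])).1 h
  exact (mem_asymptoticDirections_iff _ _).2 ⟨hu, φ, hφ, hs.comp hφ.tendsto_atTop,
    tendsto_iff_norm_sub_tendsto_zero.2 h1⟩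

/-- An asymptotic direction is a recurrent direction. -/
theorem liminf_norm_hat_sub_eq_zero {s : ℕ → EuclideanSpace ℝ (Fin d)}
    {u : EuclideanSpace ℝ (Fin d)} (h : u ∈ asymptoticDirections s) :
    liminf (fun n => ‖hat (s n) - u‖) atTop = 0 := by
  obtain ⟨hu, φ, hφ, -, h2⟩ := (mem_asymptoticDirections_iff _ _).1 h
  exact (liminf_eq_zero_iff _ 2 (fun n => norm_nonneg _) (fun n => by
    linarith [norm_sub_le (hat (s n)) u, norm_hat_le_one (s n)])).2
      ⟨φ, hφ, tendsto_iff_norm_sub_tendsto_zero.1 h2⟩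

/-- The support of a genuinely `d`-dimensional law spans the space. -/
theorem GenuinelyDimensional.span_support_eq_top {Ω : Type*} [MeasurableSpace Ω] {P : Measure Ω}
    {Y : Ω → EuclideanSpace ℝ (Fin d)} (h : GenuinelyDimensional P Y) :
    Submodule.span ℝ (P.map Y).support = ⊤ := by
  by_contra hne
  obtain ⟨f, hf, hle⟩ := Submodule.exists_le_ker_of_lt_top _ (lt_top_iff_ne_top.2 hne)
  have h1 := Module.Dual.finrank_ker_add_one_of_ne_zero hf
  rw [finrank_euclideanSpace_fin] at h1
  exact h (LinearMap.ker f) (by omega) (Submodule.subset_span.trans hle)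

end Directions

end RandomWalkDirections

/-! ### The dichotomy between transience and recurrence -/

theorem mainTheorem2 {Ω : Type*} [MeasurableSpace Ω] (P : Measure Ω) [IsProbabilityMeasure P]
    (d : ℕ) (hd : 1 ≤ d) (X : ℕ → Ω → EuclideanSpace ℝ (Fin d))
    (hmeas : ∀ n, Measurable (X n)) (hindep : iIndepFun X P)
    (hident : ∀ n, IdentDistrib (X n) (X 0) P P)
    (hdim : RandomWalkDirections.GenuinelyDimensional P (X 0)) :
    RandomWalkDirections.asAsymptoticDirections P (RandomWalkDirections.walk X) =
        RandomWalkDirections.asRecurrentDirections P (RandomWalkDirections.walk X) ∧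
      ∀ᵐ ω ∂P,
        RandomWalkDirections.asymptoticDirections (fun n => RandomWalkDirections.walk X n ω) =
          RandomWalkDirections.asRecurrentDirections P (RandomWalkDirections.walk X) := by
  open RandomWalkDirections in
  have hX : Measurable fun ω k => X k ω := measurable_pi_iff.2 hmeas
  let μ : Measure (ℕ → EuclideanSpace ℝ (Fin d)) := P.map fun ω k => X k ω
  have : IsProbabilityMeasure μ := Measure.isProbabilityMeasure_map hX.aemeasurable
  have hμ : HasIndependentShifts μ := fun n A B hA hAn hB => by
    simp only [μ]
    rw [Measure.map_apply hX (hA.inter (measurable_shift n hB)), Measure.map_apply hX hA,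
      Measure.map_apply hX hB]
    exact measure_inter_shift hmeas hindep hident n hA hAn hB
  obtain ⟨K, hK⟩ := exists_ae_asymptoticDirections_eq (μ := μ) fun B hB hinv => by
    simp only [μ]
    rw [Measure.map_apply hX hB]
    exact measure_zero_or_one_of_shift hmeas hindep hB hinv
  have hKP : ∀ᵐ ω ∂P, asymptoticDirections (fun n => walk X n ω) = K :=
    ae_of_ae_map hX.aemeasurable hK
  -- `K` is deterministic, so it can be read off from a single trajectory
  have hDinf : asAsymptoticDirections P (walk X) = K := by
    ext u
    constructor
    · rintro ⟨hu, h⟩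
      obtain ⟨ω, h1, h2⟩ := (h.and hKP).exists
      rw [← h2]
      exact ⟨hu, h1⟩
    · intro huK
      have h1 : ∀ᵐ ω ∂P, u ∈ asymptoticDirections (fun n => walk X n ω) :=
        hKP.mono fun ω h => h.symm ▸ huK
      obtain ⟨ω, hω⟩ := h1.exists
      exact ⟨hω.1, h1.mono fun ω h => h.2⟩
  have hD : asAsymptoticDirections P (walk X) = asRecurrentDirections P (walk X) := by
    ext u
    constructor
    · rintro ⟨hu, h⟩
      exact ⟨hu, h.mono fun ω hω => liminf_norm_hat_sub_eq_zero ⟨hu, hω⟩⟩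
    · rintro ⟨hu, h⟩
      have hu' : ‖u‖ = 1 := mem_sphere_zero_iff_norm.1 hu
      refine ⟨hu, ?_⟩
      by_cases htrans : ∀ᵐ x ∂μ, Tendsto (fun n => ‖partialSum x n‖) atTop atTop
      · filter_upwards [h, ae_of_ae_map hX.aemeasurable htrans] with ω h1 h2
        exact (mem_asymptoticDirections_of_tendsto hu' h2 h1).2
      · -- a recurrent walk has every unit vector as an asymptotic direction, whether or not `u` was
        -- assumed to be a recurrent direction
        have h0 := isRecurrent_zero hμ htrans
        have hsupp : (P.map (X 0)).support ⊆ recurrentSubgroup μ hμ h0 := fun y hy => by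
          refine IsPossible.mem_recurrentSubgroup hμ h0 fun ε hε => ⟨1, ?_⟩
          have h1 := ((P.map (X 0)).mem_support_iff_forall y).1 hy _ (Metric.ball_mem_nhds y hε)
          rw [Measure.map_apply (hmeas 0) measurableSet_ball] at h1
          rw [Measure.map_apply hX (measurableSet_near 1 y ε)]
          refine ne_of_gt (h1.trans_le (measure_mono fun ω hω => ?_))
          simpa [partialSum, dist_eq_norm] using hω
        have hspan := top_le_iff.1 (hdim.span_support_eq_top ▸ Submodule.span_mono hsupp)
        exact (ae_of_ae_map hX.aemeasurable
          (ae_mem_asymptoticDirections_of_span hμ h0 hspan hu')).mono fun ω hω => hω.2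
  exact ⟨hD, hD ▸ hDinf.symm ▸ hKP⟩
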